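/- For a finite group $G$, let $\Gamma(G)$ be the comaximal subgroup graph of $G$: its vertices are the non-trivial proper subgroups of $G$, and two distinct vertices $H$ and $K$ are adjacent if and only if $HK=G$, where $HK=\{hk : h\in H,\ k\in K\}$. Let $\alpha(\Gamma(G))$ be its independence number, i.e. the largest number of pairwise non-adjacent vertices. If $\alpha(\Gamma(G))\le 6$, then $G$ is supersolvable, i.e. there is a finite chain $1=N_0\le N_1\le\dots\le N_n=G$ of normal subgroups of $G$ such that every factor $N_{i+1}/N_i$ is cyclic. -/

import Mathlib

open scoped Pointwise

/-- The co-maximal subgroup graph `Γ(G)`: the vertices are the non-trivial proper subgroups of `G`;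
two distinct vertices `H`, `K` are adjacent iff the product set `H * K` is all of `G`. -/
def comaximalSubgroupGraph (G : Type*) [Group G] :
    SimpleGraph {H : Subgroup G // H ≠ ⊥ ∧ H ≠ ⊤} where
  Adj H K := H ≠ K ∧ ((H.1 : Set G) * (K.1 : Set G) = Set.univ)
  symm := ⟨fun H K h => ⟨h.1.symm, by
    have h2 := congrArg (fun s : Set G => s⁻¹) h.2
    simpa using h2⟩⟩
  loopless := ⟨fun _ h => h.1 rfl⟩

/-- `G` is supersolvable: there is a finite chain `1 = N 0 ≤ N 1 ≤ ⋯ ≤ N n = G` of subgroups, each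
normal in the whole group `G`, all of whose factors `N (i + 1) / N i` are cyclic. The factor is taken
as a subgroup of `G ⧸ N i`, namely the image of `N (i + 1)` under the quotient map. -/
def IsSupersolvableGroup (G : Type*) [Group G] : Prop :=
  ∃ (n : ℕ) (N : ℕ → Subgroup G) (_ : ∀ i, (N i).Normal),
    N 0 = ⊥ ∧ N n = ⊤ ∧
      ∀ i < n, N i ≤ N (i + 1) ∧ IsCyclic ((N (i + 1)).map (QuotientGroup.mk' (N i)))

/-! Induct on the order of `G`. Quotients do not increase the independence number, so it suffices to
find a non-trivial cyclic normal subgroup. Two conjugates of a proper subgroup never have product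
`G`, so conjugacy classes are independent, and independent families of coprime, small orders can be
joined. If a Sylow subgroup for an odd `p` is not normal, its at least 4 conjugates leave room for
at most 2 subgroups of order 2; then there is only one involution, and it is central. Hence some
non-trivial normal `p`-subgroup exists, and inside it a normal `M` of exponent `p`. If `M` is not
cyclic and every element of order prime to `p` centralises it, `M` contains a central element.
Otherwise some such `x` gives at least `p` (4 when `p = 2`) conjugates of `⟨x⟩`, which with the `p +
1` subgroups of order `p` in `M` make at least 7. -/

/-- A set of non-trivial proper subgroups, no two distinct members of which have product `G`. -/
def IsNoncomaximal {G : Type*} [Group G] (S : Set (Subgroup G)) : Prop :=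
  (∀ H ∈ S, H ≠ ⊥ ∧ H ≠ ⊤) ∧
    S.Pairwise fun H K => (H : Set G) * (K : Set G) ≠ Set.univ

/-! ### Independent families of subgroups -/

theorem IsNoncomaximal.ncard_le_indepNum {G : Type*} [Group G] [Finite G]
    {S : Set (Subgroup G)} (hS : IsNoncomaximal S) :
    S.ncard ≤ (comaximalSubgroupGraph G).indepNum := by
  classical
  let T : Set {H : Subgroup G // H ≠ ⊥ ∧ H ≠ ⊤} := Subtype.val ⁻¹' S
  have hT : T.Finite := Set.toFinite T
  have hi : (comaximalSubgroupGraph G).IsIndepSet (hT.toFinset : Set _) := by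
    intro H hH K hK hne hadj
    have hH' : H.1 ∈ S := by simpa [T] using hH
    have hK' : K.1 ∈ S := by simpa [T] using hK
    exact hS.2 hH' hK' (fun h => hne (Subtype.ext h)) hadj.2
  have h1 := hi.card_le_indepNum
  rw [← Set.ncard_eq_toFinset_card T hT] at h1
  have h2 : Subtype.val '' T = S := by
    refine (Subtype.image_preimage_coe _ _).trans ?_
    exact Set.inter_eq_right.mpr fun H hH => hS.1 H hH
  rw [← h2, Set.ncard_image_of_injective _ Subtype.val_injective]
  exact h1

theorem indepNum_quotient_le {G : Type*} [Group G] [Finite G] (N : Subgroup G) [N.Normal] :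
    (comaximalSubgroupGraph (G ⧸ N)).indepNum ≤ (comaximalSubgroupGraph G).indepNum := by
  classical
  obtain ⟨s, hs, hc⟩ := (comaximalSubgroupGraph (G ⧸ N)).exists_isNIndepSet_indepNum
  rw [← hc]
  have hsurj := QuotientGroup.mk'_surjective N
  let f : {H : Subgroup (G ⧸ N) // H ≠ ⊥ ∧ H ≠ ⊤} → Subgroup G :=
    fun H => H.1.comap (QuotientGroup.mk' N)
  have hf : Function.Injective f := fun H K h =>
    Subtype.ext (Subgroup.comap_injective hsurj h)
  rw [← Set.ncard_coe_finset s, ← Set.ncard_image_of_injective _ hf]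
  apply IsNoncomaximal.ncard_le_indepNum
  refine ⟨?_, ?_⟩
  · rintro _ ⟨H, -, rfl⟩
    refine ⟨fun h => H.2.1 ?_, fun h => H.2.2 ?_⟩
    · rw [← Subgroup.map_comap_eq_self_of_surjective hsurj H.1]
      exact (congrArg (Subgroup.map (QuotientGroup.mk' N)) h).trans (Subgroup.map_bot _)
    · exact Subgroup.comap_injective hsurj (h.trans (Subgroup.comap_top _).symm)
  · rintro _ ⟨H, hH, rfl⟩ _ ⟨K, hK, rfl⟩ hne hu
    have hne' : H ≠ K := fun h => hne (by rw [h])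
    refine hs hH hK hne' ⟨hne', Set.eq_univ_of_forall fun q => ?_⟩
    obtain ⟨g, rfl⟩ := hsurj q
    obtain ⟨a, ha, b, hb, rfl⟩ : g ∈ (f H : Set G) * (f K : Set G) := hu ▸ Set.mem_univ g
    exact ⟨_, ha, _, hb, (map_mul _ _ _).symm⟩

/-- Coprimality makes the families disjoint; the order bound keeps a mixed product from filling `G`.
-/
theorem card_add_card_le_indepNum {G : Type*} [Group G] [Finite G] {S T : Set (Subgroup G)}
    (hS : IsNoncomaximal S) (hT : IsNoncomaximal T)
    (hco : ∀ H ∈ S, ∀ K ∈ T, (Nat.card H).Coprime (Nat.card K))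
    (hlt : ∀ H ∈ S, ∀ K ∈ T, Nat.card H * Nat.card K < Nat.card G) :
    S.ncard + T.ncard ≤ (comaximalSubgroupGraph G).indepNum := by
  have hle : ∀ H K : Subgroup G, (H : Set G) * (K : Set G) = Set.univ →
      Nat.card G ≤ Nat.card H * Nat.card K := by
    intro H K h
    have := Set.natCard_mul_le (s := (H : Set G)) (t := (K : Set G))
    rw [h, Nat.card_univ] at this
    exact this
  have hdisj : Disjoint S T := by
    rw [Set.disjoint_left]
    intro H h1 h2
    exact (hS.1 H h1).1 (Subgroup.eq_bot_of_card_eq _ ((Nat.coprime_self _).mp (hco H h1 H h2)))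
  rw [← Set.ncard_union_eq hdisj]
  apply IsNoncomaximal.ncard_le_indepNum
  refine ⟨?_, ?_⟩
  · rintro H (h | h)
    exacts [hS.1 H h, hT.1 H h]
  · rintro H (h | h) K (k | k) hne hu
    · exact hS.2 h k hne hu
    · exact (hlt H h K k).not_ge (hle H K hu)
    · exact (hlt K k H h).not_ge (mul_comm (Nat.card H) _ ▸ hle H K hu)
    · exact hT.2 h k hne hu

open MulAut in
-- Writing `a * b⁻¹` as an element of the product forces `a⁻¹ * b ∈ H`. The two conjugates then
-- coincide, and their product is a proper subgroup.
theorem conj_smul_mul_conj_smul_ne_univ {G : Type*} [Group G] {H : Subgroup G} (hH : H ≠ ⊤)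
    (a b : G) :
    ((conj a • H : Subgroup G) : Set G) * ((conj b • H : Subgroup G) : Set G) ≠ Set.univ := by
  intro h
  have key : a⁻¹ * b ∈ H := by
    obtain ⟨y, hy, z, hz, hyz⟩ : a * b⁻¹ ∈ ((conj a • H : Subgroup G) : Set G) *
      ((conj b • H : Subgroup G) : Set G) := h ▸ Set.mem_univ _
    obtain ⟨u, hu, rfl⟩ := hy
    obtain ⟨v, hv, rfl⟩ := hz
    simp only [MulDistribMulAction.toMonoidEnd_apply, MulDistribMulAction.toMonoidHom_apply,
      MulAut.smul_def, MulAut.conj_apply] at hyz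
    have : a⁻¹ * b = u⁻¹ * v⁻¹ := by
      have h1 : u * (a⁻¹ * b) * v = 1 := by
        calc u * (a⁻¹ * b) * v = a⁻¹ * (a * u * a⁻¹ * (b * v * b⁻¹)) * b := by group
          _ = 1 := by rw [hyz]; group
      calc a⁻¹ * b = u⁻¹ * (u * (a⁻¹ * b) * v) * v⁻¹ := by group
        _ = _ := by rw [h1]; group
    rw [this]
    exact H.mul_mem (H.inv_mem hu) (H.inv_mem hv)
  have hab : (conj b • H : Subgroup G) = conj a • H := by
    have : conj (a⁻¹ * b) • H = H := Subgroup.conj_smul_eq_self_of_mem key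
    conv_rhs => rw [← this]
    rw [smul_smul, ← map_mul, mul_inv_cancel_left]
  rw [hab, coe_mul_coe] at h
  apply hH
  have h2 : (conj a • H : Subgroup G) = ⊤ := SetLike.coe_injective h
  rw [eq_top_iff]
  intro g _
  have : a * g * a⁻¹ ∈ conj a • H := h2 ▸ Subgroup.mem_top _
  rw [Subgroup.mem_pointwise_smul_iff_inv_smul_mem] at this
  simpa [← map_inv, MulAut.smul_def, mul_assoc] using this

theorem isNoncomaximal_of_conj {G : Type*} [Group G] {H : Subgroup G} (hb : H ≠ ⊥) (ht : H ≠ ⊤)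
    {S : Set (Subgroup G)} (hS : ∀ K ∈ S, ∃ g : G, K = MulAut.conj g • H) :
    IsNoncomaximal S := by
  refine ⟨fun K hK => ?_, fun K hK L hL _ => ?_⟩
  · obtain ⟨g, rfl⟩ := hS K hK
    refine ⟨fun h => hb ?_, fun h => ht ?_⟩
    · rw [← inv_smul_smul (MulAut.conj g) H, h, Subgroup.smul_bot]
    · by_contra hn
      apply conj_smul_mul_conj_smul_ne_univ hn g g
      rw [h]; simp
  · obtain ⟨g, rfl⟩ := hS K hK
    obtain ⟨k, rfl⟩ := hS L hL
    exact conj_smul_mul_conj_smul_ne_univ ht g k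

theorem isNoncomaximal_of_le {G : Type*} [Group G] {M : Subgroup G} (hM : M ≠ ⊤)
    {S : Set (Subgroup G)} (hS : ∀ K ∈ S, K ≠ ⊥ ∧ K ≤ M) : IsNoncomaximal S := by
  refine ⟨fun K hK => ⟨(hS K hK).1, fun h => hM (top_le_iff.mp (h ▸ (hS K hK).2))⟩,
    fun K hK L hL _ h => hM ?_⟩
  rw [eq_top_iff]
  intro g _
  obtain ⟨a, ha, b, hb, rfl⟩ : g ∈ (K : Set G) * (L : Set G) := h ▸ Set.mem_univ g
  exact M.mul_mem ((hS K hK).2 ha) ((hS L hL).2 hb)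

/-! ### Lifting supersolvability from a quotient -/

theorem isCyclic_map {G H : Type*} [Group G] [Group H] (f : G →* H) (N : Subgroup G)
    [IsCyclic N] : IsCyclic (N.map f) :=
  isCyclic_of_surjective (f.subgroupMap N) (f.subgroupMap_surjective N)

theorem isCyclic_map_comap {G : Type*} [Group G] (N : Subgroup G) [N.Normal]
    {A B : Subgroup (G ⧸ N)} [A.Normal] [h : IsCyclic (B.map (QuotientGroup.mk' A))] :
    IsCyclic ((B.comap (QuotientGroup.mk' N)).map
      (QuotientGroup.mk' (A.comap (QuotientGroup.mk' N)))) := by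
  let φ : G ⧸ A.comap (QuotientGroup.mk' N) →* (G ⧸ N) ⧸ A :=
    QuotientGroup.map _ _ (QuotientGroup.mk' N) le_rfl
  have hφ : Function.Injective φ := by
    rw [injective_iff_map_eq_one]
    intro q hq
    obtain ⟨g, rfl⟩ := QuotientGroup.mk'_surjective _ q
    have : QuotientGroup.mk' A (QuotientGroup.mk' N g) = 1 := hq
    rw [QuotientGroup.mk'_apply, QuotientGroup.eq_one_iff] at this
    rw [QuotientGroup.mk'_apply, QuotientGroup.eq_one_iff]
    exact this
  have hmem : ∀ q ∈ (B.comap (QuotientGroup.mk' N)).map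
      (QuotientGroup.mk' (A.comap (QuotientGroup.mk' N))), φ q ∈ B.map (QuotientGroup.mk' A) := by
    rintro _ ⟨g, hg, rfl⟩
    exact ⟨QuotientGroup.mk' N g, hg, rfl⟩
  refine isCyclic_of_injective ((φ.comp (Subgroup.subtype _)).codRestrict
    (B.map (QuotientGroup.mk' A)) fun q => hmem q.1 q.2) ?_
  intro a b hab
  exact Subtype.ext (hφ (congrArg Subtype.val hab))

theorem IsSupersolvableGroup.of_quotient {G : Type*} [Group G] (N : Subgroup G) [hN : N.Normal]
    [IsCyclic N] (h : IsSupersolvableGroup (G ⧸ N)) : IsSupersolvableGroup G := by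
  obtain ⟨n, K, hK, h0, hn, hi⟩ := h
  -- The chain is pulled back and shifted by one; `L 1` is `N`, so the new bottom factor is cyclic.
  let L : ℕ → Subgroup G
    | 0 => ⊥
    | j + 1 => (K j).comap (QuotientGroup.mk' N)
  have hL : ∀ i, (L i).Normal := by
    rintro (_ | i)
    · exact inferInstanceAs ((⊥ : Subgroup G).Normal)
    · exact (hK i).comap _
  refine ⟨n + 1, L, hL, rfl, ?_, ?_⟩
  · change (K n).comap _ = ⊤
    rw [hn, Subgroup.comap_top]
  · rintro (_ | i) hin
    · refine ⟨bot_le, ?_⟩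
      have h1 : L (0 + 1) = N := by
        change (K 0).comap _ = N
        rw [h0, MonoidHom.comap_bot, QuotientGroup.ker_mk']
      rw [h1]
      exact isCyclic_map (@QuotientGroup.mk' G _ (L 0) (hL 0)) N
    · have := hi i (by omega)
      have hc := this.2
      refine ⟨Subgroup.comap_mono this.1, ?_⟩
      exact isCyclic_map_comap N

/-! ### A non-trivial normal subgroup of prime power order -/

theorem exists_normal_isPGroup {G : Type*} [Group G] [Finite G] [Nontrivial G]
    (h : (comaximalSubgroupGraph G).indepNum ≤ 6) :
    ∃ p : ℕ, p.Prime ∧ ∃ N : Subgroup G, N.Normal ∧ N ≠ ⊥ ∧ IsPGroup p N := by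
  by_cases hodd : ∃ p : ℕ, p.Prime ∧ p ≠ 2 ∧ p ∣ Nat.card G
  swap
  · refine ⟨2, Nat.prime_two, ⊤, inferInstance, top_ne_bot, ?_⟩
    have hcard := Nat.eq_prime_pow_of_unique_prime_dvd (n := Nat.card G) (p := 2) Nat.card_pos.ne'
      fun {d} hd hdvd => by
        by_contra hne
        exact hodd ⟨d, hd, hne, hdvd⟩
    exact (IsPGroup.of_card hcard).to_subgroup ⊤
  obtain ⟨p, hp, hp2, hpG⟩ := hodd
  have := Fact.mk hp
  have : Fact (Nat.Prime 2) := ⟨Nat.prime_two⟩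
  obtain ⟨P⟩ : Nonempty (Sylow p G) := inferInstance
  have hPbot : (P : Subgroup G) ≠ ⊥ := P.ne_bot_of_dvd_card hpG
  by_cases hn : (P : Subgroup G).Normal
  · exact ⟨p, hp, P, hn, hPbot, P.isPGroup'⟩
  have hPtop : (P : Subgroup G) ≠ ⊤ := fun h => hn (h ▸ inferInstance)
  let S : Set (Subgroup G) := Set.range ((↑) : Sylow p G → Subgroup G)
  have hSconj : ∀ H ∈ S, ∃ g : G, H = MulAut.conj g • (P : Subgroup G) := by
    rintro _ ⟨Q, rfl⟩
    obtain ⟨g, rfl⟩ := MulAction.exists_smul_eq G P Q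
    exact ⟨g, Sylow.coe_subgroup_smul⟩
  have hS := isNoncomaximal_of_conj hPbot hPtop hSconj
  have hScard : S.ncard = Nat.card (Sylow p G) :=
    Set.ncard_range_of_injective fun _ _ h => Sylow.ext h
  have hS6 := hS.ncard_le_indepNum.trans h
  have hne1 : Nat.card (Sylow p G) ≠ 1 := by
    intro h1
    have := (Nat.card_eq_one_iff_unique.mp h1).1
    exact hn P.normal_of_subsingleton
  have hpos : 0 < Nat.card (Sylow p G) := Nat.card_pos
  have hmod := card_sylow_modEq_one p G
  have hp3 : 3 ≤ p := by have := hp.two_le; omega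
  have hdvd : p ∣ Nat.card (Sylow p G) - 1 := (Nat.modEq_iff_dvd' hpos).mp hmod.symm
  have hpodd : ¬ 2 ∣ p := fun h => hp2 ((Nat.prime_dvd_prime_iff_eq Nat.prime_two hp).mp h).symm
  -- The count is `1 + p * c` with `c ≠ 0`, and `c ≥ 2` would give at least 7. So it is `p + 1`,
  -- which is even.
  have hnp : 4 ≤ Nat.card (Sylow p G) ∧ 2 ∣ Nat.card (Sylow p G) := by
    obtain ⟨c, hc⟩ := hdvd
    have : Nat.card (Sylow p G) ≤ 6 := hScard ▸ hS6
    have hc1 : c = 1 := by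
      rcases c with _ | _ | c
      · omega
      · rfl
      · have := Nat.mul_le_mul hp3 (show 2 ≤ c + 1 + 1 by omega)
        omega
    subst hc1
    omega
  have hGcard : 4 * Nat.card P ≤ Nat.card G := by
    rw [← Subgroup.card_mul_index (P : Subgroup G), mul_comm]
    exact Nat.mul_le_mul_left _ (hnp.1.trans
      (Nat.le_of_dvd (Nat.pos_of_ne_zero Subgroup.FiniteIndex.index_ne_zero) P.card_dvd_index))
  have h2G : 2 ∣ Nat.card G :=
    hnp.2.trans (P.card_dvd_index.trans (Subgroup.index_dvd_card _))
  let T : Set (Subgroup G) := {H | Nat.card H = 2}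
  have hcardS : ∀ H ∈ S, Nat.card H = Nat.card P := by
    intro H hH
    obtain ⟨g, rfl⟩ := hSconj H hH
    exact Nat.card_congr (Subgroup.equivSMul (MulAut.conj g) (P : Subgroup G)).toEquiv.symm
  have hT : IsNoncomaximal T := by
    have hbt : ∀ H ∈ T, H ≠ ⊥ ∧ H ≠ ⊤ := by
      intro H hH
      have hH : Nat.card H = 2 := hH
      refine ⟨?_, ?_⟩
      · rintro rfl; simp at hH
      · rintro rfl
        rw [Subgroup.card_top] at hH
        have : 0 < Nat.card P := Nat.card_pos
        omega
    refine ⟨hbt, fun H hH K hK _ hu => ?_⟩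
    have hH : Nat.card H = 2 := hH
    have hK : Nat.card K = 2 := hK
    have h1 := Set.natCard_mul_le (s := (H : Set G)) (t := (K : Set G))
    rw [hu, Nat.card_univ] at h1
    have h2 : Nat.card G ≤ Nat.card H * Nat.card K := h1
    have h3 : Nat.card P ≠ 1 := fun h => hPbot (Subgroup.eq_bot_of_card_eq _ h)
    have : 0 < Nat.card P := Nat.card_pos
    rw [hH, hK] at h2
    omega
  have hcount := card_add_card_le_indepNum hT hS
    (fun H hH K hK => by
      rw [hcardS K hK, show Nat.card H = 2 from hH]
      obtain ⟨n, hn⟩ := P.isPGroup'.exists_card_eq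
      rw [hn]
      exact ((Nat.coprime_primes Nat.prime_two hp).mpr hp2.symm).pow_right n)
    (fun H hH K hK => by
      rw [hcardS K hK, show Nat.card H = 2 from hH]
      have : 0 < Nat.card P := Nat.card_pos
      omega)
  have hT2 : T.ncard ≤ 2 := by omega
  have hinv : ∀ t : G, orderOf t = 2 → Subgroup.zpowers t ∈ T := fun t ht => by
    simpa [T, Nat.card_zpowers] using ht
  have hinj : ∀ s t : G, orderOf s = 2 → orderOf t = 2 →
      Subgroup.zpowers s = Subgroup.zpowers t → s = t := by
    classical
    intro s t hs ht hst
    have h1 : s ∈ Subgroup.zpowers t := hst ▸ Subgroup.mem_zpowers s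
    rw [mem_zpowers_iff_mem_range_orderOf, ht] at h1
    simp only [Finset.range_add_one, Finset.range_zero, Finset.image_insert, pow_one, pow_zero,
      Finset.mem_insert, Finset.image_empty, Finset.notMem_empty, or_false] at h1
    rcases h1 with h1 | h1
    · exact h1
    · rw [h1, orderOf_one] at hs; omega
  obtain ⟨t, ht⟩ := exists_prime_orderOf_dvd_card' 2 h2G
  have huniq : ∀ s : G, orderOf s = 2 → s = t := by
    intro s hs
    by_contra hst
    -- A third involution, distinct from `s` and `t`.
    obtain ⟨u, hu, hus, hut⟩ : ∃ u : G, orderOf u = 2 ∧ u ≠ s ∧ u ≠ t := by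
      have hs1 : s * s = 1 := by rw [← pow_two, ← hs, pow_orderOf_eq_one]
      have ht1 : t * t = 1 := by rw [← pow_two, ← ht, pow_orderOf_eq_one]
      have hsne : s ≠ 1 := by rintro rfl; simp at hs
      have htne : t ≠ 1 := by rintro rfl; simp at ht
      have hconj : orderOf (s * t * s⁻¹) = 2 := by
        rw [← ht]
        exact MulEquiv.orderOf_eq (MulAut.conj s) t
      -- If `s` and `t` commute, their product is the third involution; otherwise a conjugate is.
      by_cases hc : s * t * s⁻¹ = t
      · have hcomm : s * t = t * s := by rwa [mul_inv_eq_iff_eq_mul] at hc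
        refine ⟨s * t, orderOf_eq_prime ?_ ?_, ?_, ?_⟩
        · rw [pow_two]
          calc s * t * (s * t) = s * t * (t * s) := by rw [hcomm]
            _ = s * (t * t) * s := by group
            _ = 1 := by rw [ht1, mul_one, hs1]
        · intro h1
          apply hst
          rw [mul_eq_one_iff_eq_inv.mp h1]
          exact inv_eq_of_mul_eq_one_left ht1
        · simpa using htne
        · simpa using hsne
      · refine ⟨s * t * s⁻¹, hconj, fun h1 => hst ?_, hc⟩
        have : s * t = s * s := by rwa [mul_inv_eq_iff_eq_mul] at h1
        exact (mul_left_cancel this).symm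
    have h3 : ({Subgroup.zpowers u, Subgroup.zpowers s, Subgroup.zpowers t} :
        Set (Subgroup G)).ncard = 3 := by
      rw [Set.ncard_eq_three]
      exact ⟨_, _, _, fun h => hus (hinj _ _ hu hs h), fun h => hut (hinj _ _ hu ht h),
        fun h => hst (hinj _ _ hs ht h), rfl⟩
    have h4 : ({Subgroup.zpowers u, Subgroup.zpowers s, Subgroup.zpowers t} :
        Set (Subgroup G)) ⊆ T := by
      rintro _ (rfl | rfl | rfl)
      exacts [hinv u hu, hinv s hs, hinv t ht]
    have := Set.ncard_le_ncard h4
    omega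
  refine ⟨2, Nat.prime_two, Subgroup.zpowers t, ⟨fun n hn g => ?_⟩, ?_, ?_⟩
  · obtain ⟨k, rfl⟩ := hn
    have : g * t * g⁻¹ = t := huniq _ (by
      rw [← ht]; exact MulEquiv.orderOf_eq (MulAut.conj g) t)
    refine ⟨k, ?_⟩
    change t ^ k = g * t ^ k * g⁻¹
    rw [← conj_zpow, this]
  · intro hb
    rw [Subgroup.zpowers_eq_bot] at hb
    rw [hb, orderOf_one] at ht
    omega
  · exact IsPGroup.of_card (n := 1) (by rw [Nat.card_zpowers, ht, pow_one])

/-! ### Normal subgroups of exponent `p` and the action on them -/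

/-- The elements of the centre of `N` killed by `p` form a characteristic subgroup of `N`,
non-trivial because a non-trivial `p`-group has non-trivial centre. -/
theorem exists_normal_forall_pow_prime_eq_one {G : Type*} [Group G] [Finite G] {p : ℕ} [Fact p.Prime]
    {N : Subgroup G} (hN : N.Normal) (hbot : N ≠ ⊥) (hp : IsPGroup p N) :
    ∃ M : Subgroup G, M.Normal ∧ M ≠ ⊥ ∧ ∀ a ∈ M, a ^ p = 1 := by
  have hnt : Nontrivial N := (Subgroup.nontrivial_iff_ne_bot N).mpr hbot
  have hpr : p.Prime := Fact.out
  let M : Subgroup G :=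
    { carrier := {a | a ∈ N ∧ (∀ b ∈ N, a * b = b * a) ∧ a ^ p = 1}
      one_mem' := ⟨N.one_mem, by simp, by simp⟩
      mul_mem' := by
        rintro a b ⟨ha, ha', hap⟩ ⟨hb, hb', hbp⟩
        refine ⟨N.mul_mem ha hb, fun c hc => ?_, ?_⟩
        · rw [mul_assoc, hb' c hc, ← mul_assoc, ha' c hc, mul_assoc]
        · rw [(show Commute a b from ha' b hb).mul_pow, hap, hbp, one_mul]
      inv_mem' := by
        rintro a ⟨ha, ha', hap⟩
        refine ⟨N.inv_mem ha, fun c hc => ?_, by rw [inv_pow, hap, inv_one]⟩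
        exact ((show Commute a c from ha' c hc).inv_left).eq }
  refine ⟨M, ⟨?_⟩, ?_, fun a ha => ha.2.2⟩
  · rintro a ⟨ha, ha', hap⟩ g
    refine ⟨hN.conj_mem a ha g, fun c hc => ?_, by rw [conj_pow, hap]; group⟩
    have h1 := ha' (g⁻¹ * c * g) (by simpa using hN.conj_mem c hc g⁻¹)
    calc g * a * g⁻¹ * c = g * (a * (g⁻¹ * c * g)) * g⁻¹ := by group
      _ = c * (g * a * g⁻¹) := by rw [h1]; group
  · have hZ := hp.center_nontrivial
    have hpZ : IsPGroup p (Subgroup.center N) := hp.to_subgroup _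
    have hdvd : p ∣ Nat.card (Subgroup.center N) :=
      hpZ.card_eq_or_dvd.resolve_left Finite.one_lt_card.ne'
    obtain ⟨z, hz⟩ := exists_prime_orderOf_dvd_card' p hdvd
    have hzM : (z : G) ∈ M := by
      refine ⟨z.1.2, fun b hb => ?_, ?_⟩
      · exact (congrArg Subtype.val (Subgroup.mem_center_iff.mp z.2 ⟨b, hb⟩)).symm
      · have : z ^ p = 1 := hz ▸ pow_orderOf_eq_one z
        exact congrArg (fun y : Subgroup.center N => (y : G)) this
    intro hb
    rw [hb, Subgroup.mem_bot] at hzM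
    have : z = 1 := Subtype.ext (Subtype.ext hzM)
    rw [this, orderOf_one] at hz
    exact hpr.one_lt.ne hz

/-- If all elements of order prime to `p` centralise a non-trivial normal `p`-subgroup, then the
subgroup contains a non-trivial central element. -/
theorem exists_central_of_coprime_centralize {G : Type*} [Group G] [Finite G] {p : ℕ}
    [hp : Fact p.Prime] {M : Subgroup G} [hM : M.Normal] (hbot : M ≠ ⊥) (hMp : IsPGroup p M)
    (hx : ∀ x : G, (orderOf x).Coprime p → ∀ m ∈ M, x * m = m * x) :
    ∃ m ∈ M, m ≠ 1 ∧ ∀ g : G, g * m = m * g := by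
  have hnt : Nontrivial M := (Subgroup.nontrivial_iff_ne_bot M).mpr hbot
  let φ : G →* MulAut M := MulAut.conjNormal
  have hφ : IsPGroup p φ.range := by
    rintro ⟨_, g, rfl⟩
    -- The power `g ^ p ^ e` has order prime to `p`, so it acts trivially: `G` acts on `M` through a
    -- `p`-group, which must fix a point other than 1.
    obtain ⟨e, n, hn, he⟩ := Nat.exists_eq_pow_mul_and_not_dvd (orderOf_pos g).ne' p hp.out.ne_one
    refine ⟨e, Subtype.ext ?_⟩
    change φ g ^ p ^ e = 1
    rw [← map_pow]
    have ho : (orderOf (g ^ p ^ e)).Coprime p := by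
      have : (g ^ p ^ e) ^ n = 1 := by rw [← pow_mul, ← he, pow_orderOf_eq_one]
      exact (((Nat.Prime.coprime_iff_not_dvd hp.out).mpr hn).symm).coprime_dvd_left
        (orderOf_dvd_of_pow_eq_one this)
    ext m
    have := hx _ ho m m.2
    change ((MulAut.conjNormal (g ^ p ^ e) m : M) : G) = m
    rw [MulAut.conjNormal_apply, this, mul_inv_cancel_right]
  have hdvd : p ∣ Nat.card M := hMp.card_eq_or_dvd.resolve_left Finite.one_lt_card.ne'
  obtain ⟨m, hm, hne⟩ := hφ.exists_fixed_point_of_prime_dvd_card_of_fixed_point M hdvd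
    (a := 1) (fun f => map_one f.1)
  refine ⟨m, m.2, fun h => hne (Subtype.ext h.symm), fun g => ?_⟩
  have h1 : φ g m = m := hm ⟨φ g, g, rfl⟩
  have h2 := congrArg Subtype.val h1
  rw [MulAut.conjNormal_apply] at h2
  exact mul_inv_eq_iff_eq_mul.mp h2

/-- A non-cyclic group of exponent `p` has at least `p + 1` subgroups of order `p`. -/
theorem succ_le_ncard_subgroups_card_prime {G : Type*} [Group G] [Finite G] {p : ℕ}
    [hp : Fact p.Prime] {M : Subgroup G} (hexp : ∀ a ∈ M, a ^ p = 1)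
    (hcyc : ∀ a ∈ M, ∃ b ∈ M, b ∉ Subgroup.zpowers a) (hbot : M ≠ ⊥) :
    p + 1 ≤ {H : Subgroup G | Nat.card H = p ∧ H ≤ M}.ncard := by
  obtain ⟨a, ha, ha1⟩ := M.ne_bot_iff_exists_ne_one.mp hbot |>.elim fun x hx =>
    (⟨x.1, x.2, fun h => hx (Subtype.ext h)⟩ : ∃ a ∈ M, a ≠ 1)
  obtain ⟨b, hb, hba⟩ := hcyc a ha
  have hcard : ∀ c ∈ M, c ≠ 1 → Nat.card (Subgroup.zpowers c) = p := fun c hc h1 => by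
    rw [Nat.card_zpowers]; exact orderOf_eq_prime (hexp c hc) h1
  have hmem : ∀ i : ℕ, b * a ^ i ∈ M := fun i => M.mul_mem hb (M.pow_mem ha i)
  have hne : ∀ i : ℕ, b * a ^ i ∉ Subgroup.zpowers a := fun i h =>
    hba ((Subgroup.mul_mem_cancel_right _ (Subgroup.npow_mem_zpowers a i)).mp h)
  have hne1 : ∀ i : ℕ, b * a ^ i ≠ 1 := fun i h => hne i (h ▸ Subgroup.one_mem _)
  -- As with the lines of a plane: `⟨a⟩` and the `p` subgroups `⟨b * a ^ i⟩`. If two of the latter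
  -- agreed, they would contain a power of `a` with exponent prime to `p`, hence `a`.
  let f : Option (Fin p) → Subgroup G := fun o =>
    o.elim (Subgroup.zpowers a) fun i => Subgroup.zpowers (b * a ^ (i : ℕ))
  have hf : ∀ o, f o ∈ {H : Subgroup G | Nat.card H = p ∧ H ≤ M} := by
    rintro (_ | i)
    · exact ⟨hcard a ha ha1, Subgroup.zpowers_le.mpr ha⟩
    · exact ⟨hcard _ (hmem i) (hne1 i), Subgroup.zpowers_le.mpr (hmem i)⟩
  have hna : ∀ i : ℕ, a ∉ Subgroup.zpowers (b * a ^ i) := by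
    intro i h
    have h1 : Subgroup.zpowers a = Subgroup.zpowers (b * a ^ i) :=
      Subgroup.eq_of_le_of_card_ge (Subgroup.zpowers_le.mpr h)
        (by rw [hcard _ (hmem i) (hne1 i), hcard a ha ha1])
    exact hne i (h1 ▸ Subgroup.mem_zpowers _)
  have hlt : ∀ i j : Fin p, i < j → f (some i) ≠ f (some j) := by
    intro i j hij h
    have h1 : b * a ^ (i : ℕ) ∈ f (some j) := h ▸ Subgroup.mem_zpowers _
    have h2 : b * a ^ (j : ℕ) ∈ f (some j) := Subgroup.mem_zpowers _
    have h3 : a ^ ((j : ℕ) - i) ∈ f (some j) := by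
      have h4 := Subgroup.mul_mem _ (Subgroup.inv_mem _ h1) h2
      have h5 : (b * a ^ (i : ℕ))⁻¹ * (b * a ^ (j : ℕ)) = a ^ ((j : ℕ) - i) := by
        rw [mul_inv_rev, mul_assoc, inv_mul_cancel_left, inv_mul_eq_iff_eq_mul, ← pow_add]
        congr 1
        have : (i : ℕ) < j := hij
        omega
      rwa [h5] at h4
    refine hna j ?_
    have hco : (orderOf a).Coprime ((j : ℕ) - i) := by
      rw [orderOf_eq_prime (hexp a ha) ha1]
      refine (Nat.Prime.coprime_iff_not_dvd hp.out).mpr fun hd => ?_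
      have : (i : ℕ) < j := hij
      have := Nat.le_of_dvd (by omega) hd
      omega
    have h6 : a ∈ Subgroup.zpowers (a ^ ((j : ℕ) - i)) :=
      mem_zpowers_pow_iff.mpr hco.symm
    exact (Subgroup.zpowers_le.mpr h3) h6
  have hinj : Function.Injective f := by
    rintro (_ | i) (_ | j) h
    · rfl
    · exact (hna j ((show Subgroup.zpowers a = Subgroup.zpowers (b * a ^ (j : ℕ)) from h) ▸ Subgroup.mem_zpowers a)).elim
    · exact (hna i ((show Subgroup.zpowers (b * a ^ (i : ℕ)) = Subgroup.zpowers a from h) ▸ Subgroup.mem_zpowers a)).elim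
    · rcases lt_trichotomy i j with hij | hij | hij
      · exact (hlt i j hij h).elim
      · rw [hij]
      · exact (hlt j i hij h.symm).elim
  calc p + 1 = (Set.range f).ncard := by
        rw [Set.ncard_range_of_injective hinj, Nat.card_eq_fintype_card]; simp
    _ ≤ _ := Set.ncard_le_ncard (Set.range_subset_iff.mpr hf)

/-- If `m ∈ M` normalises `⟨x⟩`, the commutator of `m` and `x` lies in `M ∩ ⟨x⟩ = 1`. So distinct
cosets of the centraliser give distinct conjugates. -/
theorem index_centralizer_le_ncard_conj {G : Type*} [Group G] [Finite G] {M : Subgroup G}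
    [hM : M.Normal] {x : G} (hd : Disjoint M (Subgroup.zpowers x)) :
    ((Subgroup.centralizer {x}).subgroupOf M).index ≤
      {H : Subgroup G | ∃ m ∈ M, H = MulAut.conj m • Subgroup.zpowers x}.ncard := by
  have key : ∀ m ∈ M, MulAut.conj m • Subgroup.zpowers x = Subgroup.zpowers x →
      x * m = m * x := by
    intro m hm h
    have h1 : m * x * m⁻¹ ∈ Subgroup.zpowers x := by
      rw [← h]
      exact ⟨x, Subgroup.mem_zpowers x, rfl⟩
    have h2 : m * x * m⁻¹ * x⁻¹ ∈ Subgroup.zpowers x :=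
      Subgroup.mul_mem _ h1 (Subgroup.inv_mem _ (Subgroup.mem_zpowers x))
    have h3 : m * x * m⁻¹ * x⁻¹ ∈ M := by
      have := M.mul_mem hm (hM.conj_mem _ (M.inv_mem hm) x)
      simpa [mul_assoc] using this
    have h4 := Subgroup.disjoint_def.mp hd h3 h2
    rw [mul_inv_eq_one, mul_inv_eq_iff_eq_mul] at h4
    exact h4.symm
  let C := (Subgroup.centralizer {x}).subgroupOf M
  let f : M ⧸ C → Subgroup G := fun q => MulAut.conj (q.out : G) • Subgroup.zpowers x
  have hf : Function.Injective f := by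
    intro q r h
    have h1 : MulAut.conj (((q.out⁻¹ * r.out : M) : G)) • Subgroup.zpowers x =
        Subgroup.zpowers x := by
      have h : MulAut.conj (q.out : G) • Subgroup.zpowers x =
        MulAut.conj (r.out : G) • Subgroup.zpowers x := h
      rw [Subgroup.coe_mul, map_mul, mul_smul, ← h, smul_smul, ← map_mul, Subgroup.coe_inv,
        inv_mul_cancel, map_one, one_smul]
    have h2 := key _ (Subtype.prop _) h1
    rw [← QuotientGroup.out_eq' q, ← QuotientGroup.out_eq' r]
    refine QuotientGroup.eq.mpr ?_
    rw [Subgroup.mem_subgroupOf, Subgroup.mem_centralizer_iff]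
    rintro _ rfl
    exact h2
  calc C.index = (Set.range f).ncard := by
        rw [Set.ncard_range_of_injective hf]; rfl
    _ ≤ _ := Set.ncard_le_ncard (by
      rintro _ ⟨q, rfl⟩
      exact ⟨_, (Quotient.out q).2, rfl⟩)

/-- With index 2, `x` would send `m` outside the centraliser to `m * w` with `w` fixed by `x` and `w
^ 2 = 1`. Then `x ^ 2` fixes `m`, and so does `x`, having odd order. -/
theorem index_centralizer_ne_two {G : Type*} [Group G] [Finite G] {M : Subgroup G}
    [hM : M.Normal] (hexp : ∀ a ∈ M, a ^ 2 = 1) {x : G} (hx : (orderOf x).Coprime 2) :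
    ((Subgroup.centralizer {x}).subgroupOf M).index ≠ 2 := by
  intro h2
  let C := (Subgroup.centralizer {x}).subgroupOf M
  have hC : ∀ m : M, m ∈ C ↔ x * m = m * x := by
    intro m
    rw [Subgroup.mem_subgroupOf, Subgroup.mem_centralizer_iff]
    simp
  have hmem : ∀ m : M, m ∈ C := by
    intro m
    by_contra hm
    let y : M := ⟨x * m * x⁻¹, hM.conj_mem m m.2 x⟩
    have hy : y ∉ C := by
      intro hy
      rw [hC] at hy hm
      have hy : x * (x * m * x⁻¹) = x * m * x⁻¹ * x := hy
      rw [inv_mul_cancel_right, mul_assoc x, mul_right_inj, ← mul_assoc, mul_inv_eq_iff_eq_mul] at hy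
      exact hm hy
    have hu : m * y ∈ C := (Subgroup.mul_mem_iff_of_index_two h2).mpr (iff_of_false hm hy)
    have hu2 : (m : G) * (x * m * x⁻¹) * (m * (x * m * x⁻¹)) = 1 := by
      rw [← pow_two]; exact hexp _ (m * y).2
    have hm2 : (m : G) * m = 1 := by rw [← pow_two]; exact hexp _ m.2
    rw [hC] at hu
    have hu : x * (m * (x * m * x⁻¹)) = m * (x * m * x⁻¹) * x := hu
    obtain ⟨w, hw⟩ : ∃ w : G, w = m * (x * m * x⁻¹) := ⟨_, rfl⟩
    rw [← hw] at hu hu2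
    have hxm : x * (m : G) = m * w * x := by
      rw [hw, ← mul_assoc, hm2]; group
    have hx2 : x ^ 2 * (m : G) = m * x ^ 2 := by
      calc x ^ 2 * (m : G) = x * (x * m) := by rw [pow_two, mul_assoc]
        _ = x * (m * w * x) := by rw [hxm]
        _ = x * m * w * x := by group
        _ = m * w * x * w * x := by rw [hxm]
        _ = m * w * (x * w) * x := by group
        _ = m * (w * w) * x * x := by rw [hu]; group
        _ = m * x ^ 2 := by rw [hu2, mul_one, mul_assoc, pow_two]
    have hcx : Commute (x ^ 2) (m : G) := hx2
    obtain ⟨k, hk⟩ : x ∈ Subgroup.zpowers (x ^ 2) := mem_zpowers_pow_iff.mpr hx.symm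
    have : Commute x (m : G) := by
      have := hcx.zpow_left k
      rwa [show (x ^ 2) ^ k = x from hk] at this
    exact hm ((hC m).mpr this)
  have : C = ⊤ := Subgroup.eq_top_iff' _ |>.mpr hmem
  rw [show (Subgroup.centralizer {x}).subgroupOf M = ⊤ from this, Subgroup.index_top] at h2
  omega

/-! ### A cyclic normal subgroup, and the induction -/

theorem exists_normal_isCyclic {G : Type*} [Group G] [Finite G] [Nontrivial G]
    (h : (comaximalSubgroupGraph G).indepNum ≤ 6) :
    ∃ N : Subgroup G, N.Normal ∧ N ≠ ⊥ ∧ IsCyclic N := by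
  obtain ⟨p, hp, N, hN, hNbot, hNp⟩ := exists_normal_isPGroup h
  have : Fact p.Prime := ⟨hp⟩
  obtain ⟨M, hM, hMbot, hexp⟩ := exists_normal_forall_pow_prime_eq_one hN hNbot hNp
  have hMp : IsPGroup p M := fun a => ⟨1, Subtype.ext (by simpa using hexp a a.2)⟩
  by_cases hcyc : ∀ a ∈ M, ∃ b ∈ M, b ∉ Subgroup.zpowers a
  swap
  · push Not at hcyc
    obtain ⟨a, ha, hle⟩ := hcyc
    refine ⟨M, hM, hMbot, ?_⟩
    rw [le_antisymm (show M ≤ Subgroup.zpowers a from hle) (Subgroup.zpowers_le.mpr ha)]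
    infer_instance
  by_cases hx : ∀ x : G, (orderOf x).Coprime p → ∀ m ∈ M, x * m = m * x
  · obtain ⟨m, -, hm1, hm⟩ := exists_central_of_coprime_centralize hMbot hMp hx
    refine ⟨Subgroup.zpowers m, ⟨fun n hn g => ?_⟩, by simpa using hm1, inferInstance⟩
    obtain ⟨k, rfl⟩ := hn
    have : g * m ^ k * g⁻¹ = m ^ k := by
      rw [((show Commute g m from hm g).zpow_right k).eq, mul_inv_cancel_right]
    exact this ▸ ⟨k, rfl⟩
  · push Not at hx
    obtain ⟨x, hxp, m, hm, hxm⟩ := hx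
    exfalso
    obtain ⟨e, he⟩ := hMp.exists_card_eq
    have hxM : (Nat.card M).Coprime (Nat.card (Subgroup.zpowers x)) := by
      rw [he, Nat.card_zpowers]
      exact hxp.symm.pow_left e
    have hd : Disjoint M (Subgroup.zpowers x) :=
      Subgroup.disjoint_of_coprime_natCard hxM
    have hx1 : x ≠ 1 := by rintro rfl; simp at hxm
    have hxM' : x ∉ M := fun h =>
      hx1 (Subgroup.disjoint_def.mp hd h (Subgroup.mem_zpowers x))
    have hMtop : M ≠ ⊤ := fun h => hxM' (h ▸ Subgroup.mem_top x)
    have hxtop : Subgroup.zpowers x ≠ ⊤ := fun h => by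
      rw [h, disjoint_top] at hd
      exact hMbot hd
    let S : Set (Subgroup G) := {H | Nat.card H = p ∧ H ≤ M}
    let T : Set (Subgroup G) := {H | ∃ m ∈ M, H = MulAut.conj m • Subgroup.zpowers x}
    have hS : IsNoncomaximal S := isNoncomaximal_of_le hMtop fun K hK =>
      ⟨fun hb => hp.one_lt.ne (by rw [← hK.1, hb, Subgroup.card_bot]), hK.2⟩
    have hT : IsNoncomaximal T := isNoncomaximal_of_conj (by simpa using hx1) hxtop
      fun K ⟨g, _, hg⟩ => ⟨g, hg⟩
    have hTcard : ∀ K ∈ T, Nat.card K = orderOf x := by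
      rintro _ ⟨g, -, rfl⟩
      rw [← Nat.card_zpowers]
      exact Nat.card_congr (Subgroup.equivSMul (MulAut.conj g) _).toEquiv.symm
    -- This strict inequality gives `p * orderOf x < Nat.card G`, so the two families can be joined.
    have hpM : p < Nat.card M := by
      have hS1 := succ_le_ncard_subgroups_card_prime hexp hcyc hMbot
      by_contra hle
      push Not at hle
      have hsub : S ⊆ {M} := fun H hH =>
        Subgroup.eq_of_le_of_card_ge hH.2 (by rw [hH.1]; exact hle)
      have := Set.ncard_le_ncard hsub
      rw [Set.ncard_singleton] at this
      have := hp.two_le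
      have : p + 1 ≤ S.ncard := hS1
      omega
    have hMx : Nat.card M * orderOf x ≤ Nat.card G := by
      rw [← Nat.card_zpowers, ← Nat.card_prod]
      exact Nat.card_le_card_of_injective _ (Subgroup.mul_injective_of_disjoint hd)
    have hcount := card_add_card_le_indepNum hS hT
      (fun H hH K hK => by rw [hH.1, hTcard K hK]; exact hxp.symm)
      (fun H hH K hK => by
        rw [hH.1, hTcard K hK]
        exact (Nat.mul_lt_mul_of_pos_right hpM (orderOf_pos x)).trans_le hMx)
    have hS1 : p + 1 ≤ S.ncard := succ_le_ncard_subgroups_card_prime hexp hcyc hMbot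
    let C := (Subgroup.centralizer {x}).subgroupOf M
    have hT1 : C.index ≤ T.ncard := index_centralizer_le_ncard_conj hd
    have hC1 : C.index ≠ 1 := by
      intro h1
      rw [Subgroup.index_eq_one] at h1
      have : (⟨m, hm⟩ : M) ∈ C := h1 ▸ Subgroup.mem_top _
      rw [Subgroup.mem_subgroupOf, Subgroup.mem_centralizer_iff] at this
      exact hxm (this x rfl)
    obtain ⟨n, hn⟩ := hMp.index C
    have hn0 : n ≠ 0 := by rintro rfl; exact hC1 hn
    -- The index is a power of `p` other than 1 and 2, so the total is at least `3 + 4` for `p = 2`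
    -- and `(p + 1) + p ≥ 7` for odd `p`.
    rcases hp.eq_two_or_odd with rfl | hodd
    · have hn1 : n ≠ 1 := by
        rintro rfl
        exact index_centralizer_ne_two hexp hxp hn
      have : 2 ^ 2 ≤ 2 ^ n := Nat.pow_le_pow_right (by norm_num) (by omega)
      omega
    · have : p ^ 1 ≤ p ^ n := Nat.pow_le_pow_right hp.pos (by omega)
      rw [pow_one, ← hn] at this
      have := hp.two_le
      omega

theorem corollary3p2 {G : Type*} [Group G] [Finite G]
    (h : (comaximalSubgroupGraph G).indepNum ≤ 6) : IsSupersolvableGroup G := by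
  induction hn : Nat.card G using Nat.strong_induction_on generalizing G with
  | _ n ih =>
    rcases subsingleton_or_nontrivial G with hG | hG
    · exact ⟨0, fun _ => ⊥, fun _ => inferInstance, rfl, Subsingleton.elim _ _, by simp⟩
    · obtain ⟨N, hN, hbot, hcyc⟩ := exists_normal_isCyclic h
      refine IsSupersolvableGroup.of_quotient N
        (ih _ ?_ ((indepNum_quotient_le N).trans h) rfl)
      have h1 := Subgroup.card_eq_card_quotient_mul_card_subgroup N
      have h2 : 1 < Nat.card N := (Subgroup.one_lt_card_iff_ne_bot N).mpr hbot
      have h3 : 0 < Nat.card (G ⧸ N) := Nat.card_pos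
      rw [← hn, h1]
      exact lt_mul_of_one_lt_right h3 h2
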